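/- All locally convex spaces are real and Hausdorff. A map $f\colon U\to F$ from an open subset $U$ of a locally convex space $E$ to a locally convex space $F$ is smooth if it is continuous and all iterated directional derivatives $\partial_{h_j}\cdots\partial_{h_1}f(x)$ exist and are continuous in $(x,h_1,\dots,h_j)\in U\times E^j$; smooth manifolds modeled on $E$, their tangent spaces, smooth maps and smooth vector fields are defined with this notion through charts. A *weak Poisson structure* on a smooth manifold $M$ modeled on a locally convex space is a unital subalgebra $\mathcal A_M\subseteq C^\infty(M,\mathbb R)$ with a Lie bracket $\{\cdot,\cdot\}$ on $\mathcal A_M$ such that (1) $\{F,GH\}=\{F,G\}H+G\{F,H\}$ for $F,G,H\in\mathcal A_M$; (2) if $v\in T_m(M)$ satisfies $dF(m)v=0$ for all $F\in\mathcal A_M$, then $v=0$; (3) for every $H\in\mathcal A_M$ there is a smooth vector field $X_H$ on $M$ (unique by (2)) with $dF(m)X_H(m)=\{F,H\}(m)$ for all $F\in\mathcal A_M$, $m\in M$. A *Poisson map* $f\colon M\to N$ is a smooth map between manifolds with weak Poisson structures such that $f^*\mathcal A_N\subseteq\mathcal A_M$ and $f^*\{F,G\}=\{f^*F,f^*G\}$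 for $F,G\in\mathcal A_N$, where $f^*F=F\circ f$. Let $\mathfrak g$ be a locally convex Lie algebra (a locally convex space with a continuous Lie bracket), and let $\mathfrak g'$ be its topological dual with the weak-$*$-topology, endowed with the canonical linear Poisson structure: $\mathcal A_{\mathfrak g'}$ is the unital algebra generated by the evaluations $\alpha\mapsto\alpha(X)$, $X\in\mathfrak g$, and $\{F,G\}(\alpha)=\langle[dF(\alpha),dG(\alpha)],\alpha\rangle$, where $dF(\alpha),dG(\alpha)\in(\mathfrak g')'$ are identified with elements of $\mathfrak g$. This is a weak Poisson structure on $\mathfrak g'$. **Corollary.** Let $M$ be a smooth manifold modeled on a locally convex space with a weak Poisson structure $(\mathcal A_M,\{\cdot,\cdot\})$, and let $\Phi\colon M\to\mathfrak g'$ be a map such that all functions $\phi(X)=\phi_X\colon M\to\mathbb R$, $\phi_X(m):=\Phi(m)(X)$, $X\in\mathfrak g$, are contained in $\mathcal A_M$. Then the following are equivalent: (i) $\Phi^*\mathcal A_{\mathfrak g'}\subseteq\mathcal A_M$ and $\Phi^*\colon\mathcal A_{\mathfrak g'}\to\mathcal A_M$ is a homomorphism of Lie algebras. (ii) $\phi([X,Y])=\{\phi(X),\phi(Y)\}$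 for all $X,Y\in\mathfrak g$. (iii) $T_m(\Phi)X_{\phi(X)}(m)=-\Phi(m)\circ\operatorname{ad}X$ for all $m\in M$, $X\in\mathfrak g$. Here $T_m(\Phi)v=w$ means that, in a chart of $M$ at $m$, the directional derivative of $\Phi$ at $m$ in the direction $v\in T_m(M)$ exists in the weak-$*$-topology of $\mathfrak g'$ and equals $w$. If moreover $\Phi$ is smooth as a map into $\mathfrak g'$ (so that $T_m(\Phi)$ is the usual tangent map), then (ii) and (iii) are also equivalent to $\Phi$ being a Poisson map. -/

import Mathlib

open Filter Topology Set

set_option linter.unusedSectionVars false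

namespace LCPoisson

/-! ### Calculus on locally convex spaces -/

section Calculus

variable {E F G : Type*}
  [AddCommGroup E] [Module ℝ E] [TopologicalSpace E]
  [AddCommGroup F] [Module ℝ F] [TopologicalSpace F]
  [AddCommGroup G] [Module ℝ G] [TopologicalSpace G]

/-- `f` has the derivative `w` at `x` in the direction `h`:
`w = lim_{t → 0} t⁻¹ (f (x + t h) - f x)`. -/
def HasDirDerivAt (f : E → F) (w : F) (x h : E) : Prop :=
  Tendsto (fun t : ℝ => t⁻¹ • (f (x + t • h) - f x)) (𝓝[≠] 0) (𝓝 w)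

/-- `D j x (h₁, …, h_j)` is the iterated directional derivative
`(∂_{h_j} ⋯ ∂_{h₁} f)(x)` for all `j` and all `x ∈ U`, and all the maps
`D j : U × E ^ j → F` are continuous. -/
structure IsDirDerivFamily (f : E → F) (U : Set E) (D : (j : ℕ) → E → (Fin j → E) → F) :
    Prop where
  zero_eq : ∀ x ∈ U, ∀ h : Fin 0 → E, D 0 x h = f x
  succ_deriv : ∀ (j : ℕ), ∀ x ∈ U, ∀ h : Fin (j + 1) → E,
    HasDirDerivAt (fun y => D j y (Fin.init h)) (D (j + 1) x h) x (h (Fin.last j))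
  continuousOn : ∀ j : ℕ, ContinuousOn (fun p : E × (Fin j → E) => D j p.1 p.2) (U ×ˢ univ)

/-- Smoothness (`C^∞`) of a map on an open subset `U` of a locally convex space: the map is
continuous and all iterated directional derivatives exist and are continuous on `U × E ^ j`.
Only the values of `f` on `U` matter when `U` is open. -/
def SmoothOn (f : E → F) (U : Set E) : Prop :=
  ∃ D : (j : ℕ) → E → (Fin j → E) → F, IsDirDerivFamily f U D

end Calculus

/-! ### Manifolds modeled on locally convex spaces -/

section Manifold

/-- The charts of `M` have smooth transition maps, i.e. `M` is a smooth manifold modeled on the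
locally convex space `E`. -/
class LCManifold (E : Type*) [AddCommGroup E] [Module ℝ E] [TopologicalSpace E]
    (M : Type*) [TopologicalSpace M] [ChartedSpace E M] : Prop where
  smooth_transition : ∀ e ∈ atlas E M, ∀ e' ∈ atlas E M,
    SmoothOn (fun x => e' (e.symm x)) (e.target ∩ e.symm ⁻¹' e'.source)

variable (E : Type*) [AddCommGroup E] [Module ℝ E] [TopologicalSpace E]
  (E' : Type*) [AddCommGroup E'] [Module ℝ E'] [TopologicalSpace E']
  {M : Type*} [TopologicalSpace M] [ChartedSpace E M]
  {N : Type*} [TopologicalSpace N] [ChartedSpace E' N]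

/-- The tangent space `T_m(M)`: a tangent vector is given by its coordinate vector
in the preferred chart `chartAt E m` at `m` (the same convention as Mathlib's `TangentSpace`). -/
abbrev TangentSpaceLC (_m : M) : Type _ := E

/-- Smooth maps between manifolds: continuous maps that are smooth in all charts. -/
def SmoothMap (f : M → N) : Prop :=
  Continuous f ∧ ∀ e ∈ atlas E M, ∀ e' ∈ atlas E' N,
    SmoothOn (fun x => e' (f (e.symm x))) (e.target ∩ e.symm ⁻¹' (f ⁻¹' e'.source))

variable {E E'}

/-- `T_m(f) v = w` for `v ∈ T_m(M)` and `w ∈ T_{f m}(N)`: in the preferred charts, `f` has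
the directional derivative `w` in the direction `v`. For a real-valued function `F`
(with `T_r(ℝ) = ℝ`) this says that `dF(m) v = w`. -/
def HasTangentMapAt (f : M → N) (m : M) (v : TangentSpaceLC E m)
    (w : TangentSpaceLC E' (f m)) : Prop :=
  HasDirDerivAt (fun x => chartAt E' (f m) (f ((chartAt E m).symm x))) w (chartAt E m m) v

/-- A vector field `X` is smooth if its coordinate representation `Y` in every chart `e`,
determined by `Y (e p) = T_p(e) (X p)`, is smooth. -/
def SmoothVectorField (X : (m : M) → TangentSpaceLC E m) : Prop :=
  ∀ e ∈ atlas E M, ∃ Y : E → E, SmoothOn Y e.target ∧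
    ∀ p ∈ e.source,
      HasDirDerivAt (fun x => e ((chartAt E p).symm x)) (Y (e p)) (chartAt E p p) (X p)

end Manifold

/-! ### Weak Poisson manifolds -/

section WeakPoisson

/-- A weak Poisson structure on a smooth manifold `M` modeled on a locally convex space `E`:
a unital subalgebra of `C^∞(M, ℝ)` with a Poisson bracket such that the differentials of its
elements separate the points of the tangent spaces and all its elements have smooth
Hamiltonian vector fields. -/
structure WeakPoissonStructure
    (E : Type*) [AddCommGroup E] [Module ℝ E] [TopologicalSpace E] [IsTopologicalAddGroup E]
    [ContinuousSMul ℝ E] [LocallyConvexSpace ℝ E] [T2Space E]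
    (M : Type*) [TopologicalSpace M] [ChartedSpace E M] [LCManifold E M] where
  /-- the algebra `𝒜` of admissible functions -/
  alg : Subalgebra ℝ (M → ℝ)
  smooth : ∀ F ∈ alg, SmoothMap E ℝ F
  /-- the Poisson bracket `{F, G}` -/
  bracket : alg →ₗ[ℝ] alg →ₗ[ℝ] alg
  skew : ∀ F G, bracket F G = - bracket G F
  jacobi : ∀ F G H,
    bracket F (bracket G H) = bracket (bracket F G) H + bracket G (bracket F H)
  leibniz : ∀ F G H, bracket F (G * H) = bracket F G * H + G * bracket F H
  separating : ∀ (m : M) (v : TangentSpaceLC E m),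
    (∀ F : alg, HasTangentMapAt (F : M → ℝ) m v (0 : ℝ)) → v = 0
  exists_hamiltonian : ∀ H : alg, ∃ X : (m : M) → TangentSpaceLC E m, SmoothVectorField X ∧
    ∀ (F : alg) (m : M),
      HasTangentMapAt (F : M → ℝ) m (X m) ((bracket F H : M → ℝ) m)

variable
  {E : Type*} [AddCommGroup E] [Module ℝ E] [TopologicalSpace E] [IsTopologicalAddGroup E]
  [ContinuousSMul ℝ E] [LocallyConvexSpace ℝ E] [T2Space E]
  {M : Type*} [TopologicalSpace M] [ChartedSpace E M] [LCManifold E M]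
  {E' : Type*} [AddCommGroup E'] [Module ℝ E'] [TopologicalSpace E'] [IsTopologicalAddGroup E']
  [ContinuousSMul ℝ E'] [LocallyConvexSpace ℝ E'] [T2Space E']
  {N : Type*} [TopologicalSpace N] [ChartedSpace E' N] [LCManifold E' N]

/-- The Hamiltonian vector field `X_H`, i.e. the smooth vector field with `X_H F = {F, H}` for
all `F ∈ 𝒜` (it is unique since the differentials separate the tangent vectors). -/
noncomputable def WeakPoissonStructure.ham (P : WeakPoissonStructure E M) (H : P.alg) :
    (m : M) → TangentSpaceLC E m :=
  (P.exists_hamiltonian H).choose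

/-- `f^*` maps `𝒜_N` into `𝒜_M` and is a homomorphism of Lie algebras `𝒜_N → 𝒜_M`
(its linearity is automatic). -/
def PullbackIsLieHom (P : WeakPoissonStructure E M) (Q : WeakPoissonStructure E' N)
    (f : M → N) : Prop :=
  ∃ hf : ∀ F : Q.alg, (F : N → ℝ) ∘ f ∈ P.alg,
    ∀ F G : Q.alg, (Q.bracket F G : N → ℝ) ∘ f = P.bracket ⟨_, hf F⟩ ⟨_, hf G⟩

/-- Poisson maps: smooth maps with `f^* 𝒜_N ⊆ 𝒜_M` and `f^* {F, G} = {f^* F, f^* G}`. -/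
def IsPoissonMap (P : WeakPoissonStructure E M) (Q : WeakPoissonStructure E' N)
    (f : M → N) : Prop :=
  SmoothMap E E' f ∧ PullbackIsLieHom P Q f

end WeakPoisson

/-! ### Facts on smooth maps needed to construct the linear Poisson structure -/

section CalculusFacts

variable {E F G : Type*}
  [AddCommGroup E] [Module ℝ E] [TopologicalSpace E]
  [AddCommGroup F] [Module ℝ F] [TopologicalSpace F]

theorem HasDirDerivAt.unique [T2Space F] {f : E → F} {w w' : F} {x h : E}
    (h₁ : HasDirDerivAt f w x h) (h₂ : HasDirDerivAt f w' x h) : w = w' :=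
  tendsto_nhds_unique h₁ h₂

theorem HasDirDerivAt.const (c : F) (x h : E) : HasDirDerivAt (fun _ : E => c) (0 : F) x h := by
  simp only [HasDirDerivAt, sub_self, smul_zero]
  exact tendsto_const_nhds

theorem HasDirDerivAt.linear [IsTopologicalAddGroup E] (L : E →L[ℝ] F) (x h : E) :
    HasDirDerivAt (fun y => L y) (L h) x h := by
  refine (tendsto_const_nhds (x := L h)).congr' ?_
  filter_upwards [self_mem_nhdsWithin] with t ht
  have ht' : t ≠ 0 := ht
  simp [smul_smul, inv_mul_cancel₀ ht']

theorem HasDirDerivAt.add [IsTopologicalAddGroup F] {f g : E → F} {u w : F} {x h : E}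
    (hf : HasDirDerivAt f u x h) (hg : HasDirDerivAt g w x h) :
    HasDirDerivAt (fun y => f y + g y) (u + w) x h := by
  refine (Tendsto.add hf hg).congr fun t => ?_
  rw [← smul_add, add_sub_add_comm]

theorem HasDirDerivAt.tendsto_line [IsTopologicalAddGroup F] [ContinuousSMul ℝ F]
    {f : E → F} {w : F} {x h : E} (hf : HasDirDerivAt f w x h) :
    Tendsto (fun t : ℝ => f (x + t • h)) (𝓝[≠] 0) (𝓝 (f x)) := by
  have h0 : Tendsto (fun t : ℝ => t) (𝓝[≠] 0) (𝓝 0) := tendsto_nhdsWithin_of_tendsto_nhds tendsto_id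
  have h1 := (h0.smul hf).add (tendsto_const_nhds (x := f x))
  rw [zero_smul, zero_add] at h1
  refine h1.congr' ?_
  filter_upwards [self_mem_nhdsWithin] with t ht
  have ht' : t ≠ 0 := ht
  simp [smul_smul, mul_inv_cancel₀ ht']

theorem HasDirDerivAt.smul [IsTopologicalAddGroup F] [ContinuousSMul ℝ F]
    {f : E → ℝ} {g : E → F} {u : ℝ} {w : F} {x h : E}
    (hf : HasDirDerivAt f u x h) (hg : HasDirDerivAt g w x h) :
    HasDirDerivAt (fun y => f y • g y) (u • g x + f x • w) x h := by
  have h1 := (Tendsto.smul hf hg.tendsto_line).add (Tendsto.const_smul hg (f x))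
  refine h1.congr fun t => ?_
  simp only [smul_eq_mul, smul_sub, smul_smul, sub_smul, mul_sub]
  rw [mul_comm (f x) t⁻¹, sub_add_sub_cancel]

theorem SmoothOn.const (c : F) (U : Set E) : SmoothOn (fun _ : E => c) U := by
  refine ⟨fun j _ _ => if j = 0 then c else 0, ⟨by simp, fun j x _ h => ?_, fun j => ?_⟩⟩
  · simpa using HasDirDerivAt.const _ x _
  · exact continuousOn_const

theorem SmoothOn.linear [IsTopologicalAddGroup E] (L : E →L[ℝ] F) (U : Set E) :
    SmoothOn (fun y => L y) U := by
  refine ⟨fun j => match j with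
    | 0 => fun x _ => L x
    | 1 => fun _ h => L (h 0)
    | _ + 2 => fun _ _ => 0, ⟨by simp, fun j x _ h => ?_, fun j => ?_⟩⟩
  · match j with
    | 0 => exact HasDirDerivAt.linear L x _
    | 1 => exact HasDirDerivAt.const _ x _
    | j + 2 => exact HasDirDerivAt.const _ x _
  · match j with
    | 0 => exact (L.continuous.comp continuous_fst).continuousOn
    | 1 => exact (L.continuous.comp ((continuous_apply 0).comp continuous_snd)).continuousOn
    | j + 2 => exact continuousOn_const

theorem SmoothOn.add [IsTopologicalAddGroup F] {f g : E → F} {U : Set E}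
    (hf : SmoothOn f U) (hg : SmoothOn g U) : SmoothOn (fun y => f y + g y) U := by
  obtain ⟨D, hD⟩ := hf
  obtain ⟨D', hD'⟩ := hg
  refine ⟨fun j x h => D j x h + D' j x h, ⟨fun x hx h => ?_, fun j x hx h => ?_, fun j => ?_⟩⟩
  · simp only [hD.zero_eq x hx, hD'.zero_eq x hx]
  · exact (hD.succ_deriv j x hx h).add (hD'.succ_deriv j x hx h)
  · exact (hD.continuousOn j).add (hD'.continuousOn j)

/-- Sums of products of iterated derivatives, as they occur in the higher product rule. -/
inductive LeibnizTerm (Df : (j : ℕ) → E → (Fin j → E) → ℝ) (Dg : (j : ℕ) → E → (Fin j → E) → F)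
    (j : ℕ) : (E → (Fin j → E) → F) → Prop
  | basic (a b : ℕ) (σ : Fin a → Fin j) (τ : Fin b → Fin j) :
      LeibnizTerm Df Dg j (fun x h => Df a x (h ∘ σ) • Dg b x (h ∘ τ))
  | add {T T' : E → (Fin j → E) → F} :
      LeibnizTerm Df Dg j T → LeibnizTerm Df Dg j T' →
      LeibnizTerm Df Dg j (fun x h => T x h + T' x h)

theorem LeibnizTerm.succ [IsTopologicalAddGroup F] [ContinuousSMul ℝ F]
    {f : E → ℝ} {g : E → F} {U : Set E}
    {Df : (j : ℕ) → E → (Fin j → E) → ℝ} {Dg : (j : ℕ) → E → (Fin j → E) → F}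
    (hf : IsDirDerivFamily f U Df) (hg : IsDirDerivFamily g U Dg)
    {j : ℕ} {T : E → (Fin j → E) → F} (hT : LeibnizTerm Df Dg j T) :
    ∃ T' : E → (Fin (j + 1) → E) → F, LeibnizTerm Df Dg (j + 1) T' ∧
      ∀ x ∈ U, ∀ h : Fin (j + 1) → E,
        HasDirDerivAt (fun y => T y (Fin.init h)) (T' x h) x (h (Fin.last j)) := by
  induction hT with
  | basic a b σ τ =>
    refine ⟨_, .add
      (.basic (a + 1) b (Fin.snoc (α := fun _ => Fin (j + 1)) (Fin.castSucc ∘ σ) (Fin.last j))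
        (Fin.castSucc ∘ τ))
      (.basic a (b + 1) (Fin.castSucc ∘ σ)
        (Fin.snoc (α := fun _ => Fin (j + 1)) (Fin.castSucc ∘ τ) (Fin.last j))), ?_⟩
    intro x hx h
    have key : ∀ {c : ℕ} (ρ : Fin c → Fin j),
        Fin.init (α := fun _ => E)
          (h ∘ (Fin.snoc (α := fun _ => Fin (j + 1)) (Fin.castSucc ∘ ρ) (Fin.last j)))
          = Fin.init (α := fun _ => E) h ∘ ρ := by
      intro c ρ
      funext i
      simp [Fin.init]
    have h1 := hf.succ_deriv a x hx
      (h ∘ (Fin.snoc (α := fun _ => Fin (j + 1)) (Fin.castSucc ∘ σ) (Fin.last j)))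
    have h2 := hg.succ_deriv b x hx
      (h ∘ (Fin.snoc (α := fun _ => Fin (j + 1)) (Fin.castSucc ∘ τ) (Fin.last j)))
    rw [key] at h1 h2
    simp only [Function.comp_apply, Fin.snoc_last] at h1 h2
    exact h1.smul h2
  | add _ _ ih1 ih2 =>
    obtain ⟨T1, hT1, h1⟩ := ih1
    obtain ⟨T2, hT2, h2⟩ := ih2
    exact ⟨_, .add hT1 hT2, fun x hx h => (h1 x hx h).add (h2 x hx h)⟩

theorem LeibnizTerm.continuousOn [IsTopologicalAddGroup F] [ContinuousSMul ℝ F]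
    {f : E → ℝ} {g : E → F} {U : Set E}
    {Df : (j : ℕ) → E → (Fin j → E) → ℝ} {Dg : (j : ℕ) → E → (Fin j → E) → F}
    (hf : IsDirDerivFamily f U Df) (hg : IsDirDerivFamily g U Dg)
    {j : ℕ} {T : E → (Fin j → E) → F} (hT : LeibnizTerm Df Dg j T) :
    ContinuousOn (fun p : E × (Fin j → E) => T p.1 p.2) (U ×ˢ univ) := by
  induction hT with
  | basic a b σ τ =>
    have hc : ∀ {c : ℕ} (ρ : Fin c → Fin j),
        Continuous (fun p : E × (Fin j → E) => ((p.1, p.2 ∘ ρ) : E × (Fin c → E))) := by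
      intro c ρ
      refine continuous_fst.prodMk (continuous_pi fun i => ?_)
      exact (continuous_apply (ρ i)).comp continuous_snd
    refine ContinuousOn.smul ?_ ?_
    · exact (hf.continuousOn a).comp (hc σ).continuousOn fun p hp => ⟨hp.1, trivial⟩
    · exact (hg.continuousOn b).comp (hc τ).continuousOn fun p hp => ⟨hp.1, trivial⟩
  | add _ _ ih1 ih2 => exact ih1.add ih2

theorem SmoothOn.smul [IsTopologicalAddGroup F] [ContinuousSMul ℝ F]
    {f : E → ℝ} {g : E → F} {U : Set E}
    (hf : SmoothOn f U) (hg : SmoothOn g U) : SmoothOn (fun y => f y • g y) U := by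
  obtain ⟨Df, hDf⟩ := hf
  obtain ⟨Dg, hDg⟩ := hg
  let S : (j : ℕ) → {T : E → (Fin j → E) → F // LeibnizTerm Df Dg j T} := fun j =>
    Nat.rec (motive := fun j => {T : E → (Fin j → E) → F // LeibnizTerm Df Dg j T})
      ⟨_, .basic 0 0 Fin.elim0 Fin.elim0⟩
      (fun _ T => ⟨_, (T.2.succ hDf hDg).choose_spec.1⟩) j
  refine ⟨fun j => (S j).1, ⟨fun x hx h => ?_, fun j x hx h => ?_, fun j => ?_⟩⟩
  · change Df 0 x _ • Dg 0 x _ = _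
    rw [hDf.zero_eq x hx, hDg.zero_eq x hx]
  · exact ((S j).2.succ hDf hDg).choose_spec.2 x hx h
  · exact (S j).2.continuousOn hDf hDg

variable [IsTopologicalAddGroup E]

/-- A locally convex space is a manifold modeled on itself. -/
instance instLCManifoldSelf : LCManifold E E where
  smooth_transition := by
    intro e he e' he'
    rw [chartedSpaceSelf_atlas] at he he'
    subst he he'
    exact SmoothOn.linear (ContinuousLinearMap.id ℝ E) _

theorem smoothMap_self [IsTopologicalAddGroup F] {f : E → F} (hf : Continuous f)
    (h : SmoothOn f univ) : SmoothMap E F f := by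
  refine ⟨hf, fun e he e' he' => ?_⟩
  rw [chartedSpaceSelf_atlas] at he he'
  subst he he'
  simpa using h

theorem hasTangentMapAt_self {f : E → F} {x v : E} {w : F} :
    HasTangentMapAt (E := E) (E' := F) f x v w ↔ HasDirDerivAt f w x v := by
  simp only [HasTangentMapAt, chartAt_self_eq]
  rfl

theorem smoothVectorField_self {X : E → E} (h : SmoothOn X univ) :
    SmoothVectorField (E := E) (M := E) X := by
  intro e he
  rw [chartedSpaceSelf_atlas] at he
  subst he
  refine ⟨X, by simpa using h, fun p _ => ?_⟩
  simp only [chartAt_self_eq]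
  exact HasDirDerivAt.linear (ContinuousLinearMap.id ℝ E) p (X p)

end CalculusFacts

/-! ### The canonical linear Poisson structure on the dual of a locally convex Lie algebra -/

/-- The Lie bracket is continuous. A locally convex Lie algebra is a locally convex space with a
continuous Lie bracket. -/
class ContinuousLieBracket (𝔤 : Type*) [LieRing 𝔤] [TopologicalSpace 𝔤] : Prop where
  continuous_lie : Continuous fun p : 𝔤 × 𝔤 => ⁅p.1, p.2⁆

section LinearPoisson

instance instLocallyConvexSpaceWeakDual (V : Type*) [AddCommGroup V] [Module ℝ V]
    [TopologicalSpace V] : LocallyConvexSpace ℝ (WeakDual ℝ V) :=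
  inferInstanceAs (LocallyConvexSpace ℝ (WeakBilin (topDualPairing ℝ V)))

variable (𝔤 : Type*) [LieRing 𝔤] [LieAlgebra ℝ 𝔤] [TopologicalSpace 𝔤]
  [IsTopologicalAddGroup 𝔤] [ContinuousSMul ℝ 𝔤]

/-- `α ∘ ad X` for `α ∈ 𝔤'`, as an element of `𝔤'`. -/
noncomputable def compAd {𝔤 : Type*} [LieRing 𝔤] [LieAlgebra ℝ 𝔤] [TopologicalSpace 𝔤]
    [ContinuousLieBracket 𝔤] (α : WeakDual ℝ 𝔤) (X : 𝔤) : WeakDual ℝ 𝔤 :=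
  StrongDual.toWeakDual
    ((WeakDual.toStrongDual α).comp
      { toLinearMap := (LieAlgebra.ad ℝ 𝔤 X : 𝔤 →ₗ[ℝ] 𝔤)
        cont := (ContinuousLieBracket.continuous_lie (𝔤 := 𝔤)).comp
          (continuous_const.prodMk continuous_id) })

/-- The algebra of functions on `𝔤'` generated by the evaluations `α ↦ α X`, `X ∈ 𝔤`. -/
def linearAlg : Subalgebra ℝ (WeakDual ℝ 𝔤 → ℝ) :=
  Algebra.adjoin ℝ (range fun (X : 𝔤) (α : WeakDual ℝ 𝔤) => α X)

variable {𝔤}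

@[simp]
theorem compAd_apply [ContinuousLieBracket 𝔤] (α : WeakDual ℝ 𝔤) (X Y : 𝔤) :
    compAd α X Y = α ⁅X, Y⁆ := rfl

/-- The differential `dF(α) : 𝔤' → ℝ` is the evaluation in `X ∈ 𝔤`. -/
def IsDifferential (F : WeakDual ℝ 𝔤 → ℝ) (α : WeakDual ℝ 𝔤) (X : 𝔤) : Prop :=
  ∀ β : WeakDual ℝ 𝔤, HasDirDerivAt F (β X) α β

open Classical in
/-- The differential `dF(α)`, as an element of `𝔤` (by convention `0` if there is no such
element; this never happens for `F` in `linearAlg 𝔤`). -/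
noncomputable def differential (F : WeakDual ℝ 𝔤 → ℝ) (α : WeakDual ℝ 𝔤) : 𝔤 :=
  if h : ∃ X, IsDifferential F α X then h.choose else 0

/-- Evaluation in `X` as a continuous linear functional on `𝔤'`. -/
noncomputable def evalCLM (X : 𝔤) : WeakDual ℝ 𝔤 →L[ℝ] ℝ where
  toFun α := α X
  map_add' _ _ := rfl
  map_smul' _ _ := rfl
  cont := WeakDual.eval_continuous X

theorem eval_mem (X : 𝔤) : (fun α : WeakDual ℝ 𝔤 => α X) ∈ linearAlg 𝔤 :=
  Algebra.subset_adjoin ⟨X, rfl⟩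

theorem isDifferential_eval (X : 𝔤) (α : WeakDual ℝ 𝔤) :
    IsDifferential (fun α : WeakDual ℝ 𝔤 => α X) α X :=
  fun β => HasDirDerivAt.linear (evalCLM X) α β

theorem isDifferential_const (c : ℝ) (α : WeakDual ℝ 𝔤) :
    IsDifferential (algebraMap ℝ (WeakDual ℝ 𝔤 → ℝ) c) α 0 := fun β => by
  rw [map_zero]
  exact HasDirDerivAt.const c α β

theorem IsDifferential.add {F G : WeakDual ℝ 𝔤 → ℝ} {α : WeakDual ℝ 𝔤} {X Y : 𝔤}
    (hF : IsDifferential F α X) (hG : IsDifferential G α Y) :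
    IsDifferential (F + G) α (X + Y) := fun β => by
  rw [map_add]
  exact (hF β).add (hG β)

theorem IsDifferential.mul {F G : WeakDual ℝ 𝔤 → ℝ} {α : WeakDual ℝ 𝔤} {X Y : 𝔤}
    (hF : IsDifferential F α X) (hG : IsDifferential G α Y) :
    IsDifferential (F * G) α (G α • X + F α • Y) := fun β => by
  have h := (hF β).smul (hG β)
  rw [map_add, map_smul, map_smul, smul_eq_mul (G α), mul_comm (G α)]
  exact h

theorem exists_isDifferential {F : WeakDual ℝ 𝔤 → ℝ} (hF : F ∈ linearAlg 𝔤) (α : WeakDual ℝ 𝔤) :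
    ∃ X, IsDifferential F α X := by
  induction hF using Algebra.adjoin_induction with
  | mem F hF =>
    obtain ⟨X, rfl⟩ := hF
    exact ⟨X, isDifferential_eval X α⟩
  | algebraMap r => exact ⟨0, isDifferential_const r α⟩
  | add F G _ _ hF hG => exact ⟨_, hF.choose_spec.add hG.choose_spec⟩
  | mul F G _ _ hF hG => exact ⟨_, hF.choose_spec.mul hG.choose_spec⟩

theorem isDifferential_differential {F : WeakDual ℝ 𝔤 → ℝ} (hF : F ∈ linearAlg 𝔤)
    (α : WeakDual ℝ 𝔤) : IsDifferential F α (differential F α) := by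
  have h := exists_isDifferential hF α
  rw [differential, dif_pos h]
  exact h.choose_spec

theorem smoothOn_of_mem {F : WeakDual ℝ 𝔤 → ℝ} (hF : F ∈ linearAlg 𝔤) : SmoothOn F univ := by
  induction hF using Algebra.adjoin_induction with
  | mem F hF =>
    obtain ⟨X, rfl⟩ := hF
    exact SmoothOn.linear (evalCLM X) _
  | algebraMap r => exact SmoothOn.const r _
  | add F G _ _ hF hG => exact hF.add hG
  | mul F G _ _ hF hG => exact hF.smul hG

theorem continuous_of_mem {F : WeakDual ℝ 𝔤 → ℝ} (hF : F ∈ linearAlg 𝔤) : Continuous F := by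
  induction hF using Algebra.adjoin_induction with
  | mem F hF =>
    obtain ⟨X, rfl⟩ := hF
    exact WeakDual.eval_continuous X
  | algebraMap r => exact continuous_const
  | add F G _ _ hF hG => exact hF.add hG
  | mul F G _ _ hF hG => exact hF.mul hG

variable [LocallyConvexSpace ℝ 𝔤] [T2Space 𝔤]

theorem IsDifferential.eq_differential {F : WeakDual ℝ 𝔤 → ℝ} {α : WeakDual ℝ 𝔤} {X : 𝔤}
    (h : IsDifferential F α X) : differential F α = X := by
  have h' : ∃ X, IsDifferential F α X := ⟨X, h⟩
  rw [differential, dif_pos h']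
  by_contra hne
  obtain ⟨β, hβ⟩ := SeparatingDual.exists_separating_of_ne (R := ℝ) hne
  exact hβ ((h'.choose_spec (StrongDual.toWeakDual β)).unique (h (StrongDual.toWeakDual β)))

theorem differential_eval (X : 𝔤) (α : WeakDual ℝ 𝔤) :
    differential (fun α : WeakDual ℝ 𝔤 => α X) α = X :=
  (isDifferential_eval X α).eq_differential

theorem differential_const (c : ℝ) (α : WeakDual ℝ 𝔤) :
    differential (algebraMap ℝ (WeakDual ℝ 𝔤 → ℝ) c) α = 0 :=
  (isDifferential_const c α).eq_differential

theorem differential_add {F G : WeakDual ℝ 𝔤 → ℝ} (hF : F ∈ linearAlg 𝔤) (hG : G ∈ linearAlg 𝔤)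
    (α : WeakDual ℝ 𝔤) : differential (F + G) α = differential F α + differential G α :=
  ((isDifferential_differential hF α).add (isDifferential_differential hG α)).eq_differential

theorem differential_mul {F G : WeakDual ℝ 𝔤 → ℝ} (hF : F ∈ linearAlg 𝔤) (hG : G ∈ linearAlg 𝔤)
    (α : WeakDual ℝ 𝔤) :
    differential (F * G) α = G α • differential F α + F α • differential G α :=
  ((isDifferential_differential hF α).mul (isDifferential_differential hG α)).eq_differential

theorem differential_smul (c : ℝ) {F : WeakDual ℝ 𝔤 → ℝ} (hF : F ∈ linearAlg 𝔤)
    (α : WeakDual ℝ 𝔤) : differential (c • F) α = c • differential F α := by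
  rw [Algebra.smul_def, differential_mul (algebraMap_mem _ c) hF, differential_const]
  simp

/-- The bracket `{F, G}(α) = ⟨[dF(α), dG(α)], α⟩`. -/
noncomputable def linearBracket (F G : WeakDual ℝ 𝔤 → ℝ) : WeakDual ℝ 𝔤 → ℝ :=
  fun α => α ⁅differential F α, differential G α⁆

theorem linearBracket_swap (F G : WeakDual ℝ 𝔤 → ℝ) :
    linearBracket F G = - linearBracket G F := by
  funext α
  simp only [linearBracket, Pi.neg_apply]
  rw [← lie_skew, map_neg]

theorem linearBracket_add {F G H : WeakDual ℝ 𝔤 → ℝ} (hG : G ∈ linearAlg 𝔤)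
    (hH : H ∈ linearAlg 𝔤) :
    linearBracket F (G + H) = linearBracket F G + linearBracket F H := by
  funext α
  simp [linearBracket, differential_add hG hH]

theorem linearBracket_smul (c : ℝ) {F G : WeakDual ℝ 𝔤 → ℝ} (hG : G ∈ linearAlg 𝔤) :
    linearBracket F (c • G) = c • linearBracket F G := by
  funext α
  simp [linearBracket, differential_smul c hG]

theorem linearBracket_mul {F G H : WeakDual ℝ 𝔤 → ℝ} (hG : G ∈ linearAlg 𝔤)
    (hH : H ∈ linearAlg 𝔤) :
    linearBracket F (G * H) = linearBracket F G * H + G * linearBracket F H := by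
  funext α
  simp [linearBracket, differential_mul hG hH]
  ring

theorem linearBracket_const (F : WeakDual ℝ 𝔤 → ℝ) (c : ℝ) :
    linearBracket F (algebraMap ℝ (WeakDual ℝ 𝔤 → ℝ) c) = 0 := by
  funext α
  simp only [linearBracket, differential_const, lie_zero, map_zero, Pi.zero_apply]

theorem linearBracket_eval (X Y : 𝔤) :
    linearBracket (fun α : WeakDual ℝ 𝔤 => α X) (fun α => α Y) = fun α => α ⁅X, Y⁆ := by
  funext α
  simp only [linearBracket, differential_eval]

theorem linearBracket_mem {F G : WeakDual ℝ 𝔤 → ℝ} (hF : F ∈ linearAlg 𝔤)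
    (hG : G ∈ linearAlg 𝔤) : linearBracket F G ∈ linearAlg 𝔤 := by
  induction hG using Algebra.adjoin_induction with
  | mem G hG =>
    obtain ⟨Y, rfl⟩ := hG
    rw [linearBracket_swap]
    refine neg_mem ?_
    induction hF using Algebra.adjoin_induction with
    | mem F hF =>
      obtain ⟨X, rfl⟩ := hF
      rw [linearBracket_eval]
      exact eval_mem _
    | algebraMap r => rw [linearBracket_const]; exact zero_mem _
    | add F G hF hG h1 h2 => rw [linearBracket_add hF hG]; exact add_mem h1 h2
    | mul F G hF hG h1 h2 =>
      rw [linearBracket_mul hF hG]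
      exact add_mem (mul_mem h1 hG) (mul_mem hF h2)
  | algebraMap r => rw [linearBracket_const]; exact zero_mem _
  | add G H hG hH h1 h2 => rw [linearBracket_add hG hH]; exact add_mem h1 h2
  | mul G H hG hH h1 h2 =>
    rw [linearBracket_mul hG hH]
    exact add_mem (mul_mem h1 hH) (mul_mem hG h2)

/-- The Poisson bracket on `linearAlg 𝔤`. -/
noncomputable def linearBracketₗ : linearAlg 𝔤 →ₗ[ℝ] linearAlg 𝔤 →ₗ[ℝ] linearAlg 𝔤 :=
  LinearMap.mk₂ ℝ (fun F G => ⟨linearBracket F.1 G.1, linearBracket_mem F.2 G.2⟩)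
    (fun F G H => Subtype.ext <| by
      change linearBracket (F.1 + G.1) H.1 = linearBracket F.1 H.1 + linearBracket G.1 H.1
      rw [linearBracket_swap, linearBracket_add F.2 G.2, linearBracket_swap F.1,
        linearBracket_swap G.1, neg_add])
    (fun c F G => Subtype.ext <| by
      change linearBracket (c • F.1) G.1 = c • linearBracket F.1 G.1
      rw [linearBracket_swap, linearBracket_smul c F.2, linearBracket_swap F.1, smul_neg])
    (fun F G H => Subtype.ext <| linearBracket_add G.2 H.2)
    (fun c F G => Subtype.ext <| linearBracket_smul c G.2)

theorem linearBracketₗ_skew (F G : linearAlg 𝔤) :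
    linearBracketₗ F G = - linearBracketₗ G F :=
  Subtype.ext (linearBracket_swap F.1 G.1)

theorem linearBracketₗ_leibniz (F G H : linearAlg 𝔤) :
    linearBracketₗ F (G * H) = linearBracketₗ F G * H + G * linearBracketₗ F H :=
  Subtype.ext (linearBracket_mul G.2 H.2)

theorem linearBracketₗ_leibniz_left (F G H : linearAlg 𝔤) :
    linearBracketₗ (F * G) H = F * linearBracketₗ G H + linearBracketₗ F H * G := by
  rw [linearBracketₗ_skew, linearBracketₗ_leibniz, linearBracketₗ_skew H F,
    linearBracketₗ_skew H G]
  ring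

theorem linearBracketₗ_const (F : linearAlg 𝔤) (c : ℝ) :
    linearBracketₗ F (algebraMap ℝ (linearAlg 𝔤) c) = 0 :=
  Subtype.ext (linearBracket_const F.1 c)

theorem linearBracketₗ_const_left (F : linearAlg 𝔤) (c : ℝ) :
    linearBracketₗ (algebraMap ℝ (linearAlg 𝔤) c) F = 0 := by
  rw [linearBracketₗ_skew, linearBracketₗ_const, neg_zero]

/-- Induction over the generators of `linearAlg 𝔤`. -/
theorem linearAlg_induction {p : linearAlg 𝔤 → Prop}
    (eval : ∀ X : 𝔤, p ⟨fun α => α X, eval_mem X⟩)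
    (const : ∀ c : ℝ, p (algebraMap ℝ (linearAlg 𝔤) c))
    (add : ∀ F G, p F → p G → p (F + G)) (mul : ∀ F G, p F → p G → p (F * G))
    (F : linearAlg 𝔤) : p F := by
  obtain ⟨F, hF⟩ := F
  induction hF using Algebra.adjoin_induction with
  | mem F hF =>
    obtain ⟨X, rfl⟩ := hF
    exact eval X
  | algebraMap r => exact const r
  | add F G hF hG h1 h2 => exact add ⟨F, hF⟩ ⟨G, hG⟩ h1 h2
  | mul F G hF hG h1 h2 => exact mul ⟨F, hF⟩ ⟨G, hG⟩ h1 h2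

theorem linearBracketₗ_jacobi (F G H : linearAlg 𝔤) :
    linearBracketₗ F (linearBracketₗ G H) =
      linearBracketₗ (linearBracketₗ F G) H + linearBracketₗ G (linearBracketₗ F H) := by
  induction F using linearAlg_induction with
  | const c => simp [linearBracketₗ_const_left]
  | add F F' h1 h2 => simp only [map_add, LinearMap.add_apply, h1, h2]; ring
  | mul F F' h1 h2 =>
    simp only [linearBracketₗ_leibniz_left, linearBracketₗ_leibniz, map_add,
      LinearMap.add_apply, h1, h2]
    rw [linearBracketₗ_skew F G, linearBracketₗ_skew F' G]
    ring
  | eval X =>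
    induction G using linearAlg_induction with
    | const c => simp [linearBracketₗ_const_left, linearBracketₗ_const]
    | add F F' h1 h2 => simp only [map_add, LinearMap.add_apply, h1, h2]; ring
    | mul F F' h1 h2 =>
      simp only [linearBracketₗ_leibniz_left, linearBracketₗ_leibniz, map_add,
        LinearMap.add_apply, h1, h2]
      ring
    | eval Y =>
      induction H using linearAlg_induction with
      | const c => simp [linearBracketₗ_const]
      | add F F' h1 h2 => simp only [map_add, h1, h2]; ring
      | mul F F' h1 h2 =>
        simp only [linearBracketₗ_leibniz, map_add, h1, h2]
        ring
      | eval Z =>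
        apply Subtype.ext
        change linearBracket _ (linearBracket _ _) =
          linearBracket (linearBracket _ _) _ + linearBracket _ (linearBracket _ _)
        simp only [linearBracket_eval]
        funext α
        simp only [Pi.add_apply]
        rw [← map_add, leibniz_lie X Y Z]

variable [ContinuousLieBracket 𝔤]

/-- The continuous linear map `α ↦ - α ∘ ad X` of `𝔤'`. -/
noncomputable def negCompAdCLM (X : 𝔤) : WeakDual ℝ 𝔤 →L[ℝ] WeakDual ℝ 𝔤 where
  toFun α := - compAd α X
  map_add' α β := by
    rw [← neg_add]
    rfl
  map_smul' c α := by
    rw [RingHom.id_apply, smul_neg]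
    rfl
  cont := by
    refine continuous_neg.comp (WeakDual.continuous_of_continuous_eval fun Y => ?_)
    exact WeakDual.eval_continuous ⁅X, Y⁆

theorem compAd_add (α : WeakDual ℝ 𝔤) (X Y : 𝔤) :
    compAd α (X + Y) = compAd α X + compAd α Y := by
  refine DFunLike.ext _ _ fun Z => ?_
  change α ⁅X + Y, Z⁆ = α ⁅X, Z⁆ + α ⁅Y, Z⁆
  rw [add_lie, map_add]

theorem compAd_smul (α : WeakDual ℝ 𝔤) (c : ℝ) (X : 𝔤) :
    compAd α (c • X) = c • compAd α X := by
  refine DFunLike.ext _ _ fun Z => ?_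
  change α ⁅c • X, Z⁆ = c • α ⁅X, Z⁆
  rw [smul_lie, map_smul]

theorem smoothOn_linearHam {H : WeakDual ℝ 𝔤 → ℝ} (hH : H ∈ linearAlg 𝔤) :
    SmoothOn (fun α => - compAd α (differential H α)) univ := by
  induction hH using Algebra.adjoin_induction with
  | mem F hF =>
    obtain ⟨X, rfl⟩ := hF
    simp only [differential_eval]
    exact SmoothOn.linear (negCompAdCLM X) _
  | algebraMap r =>
    simp only [differential_const]
    exact SmoothOn.linear (negCompAdCLM 0) _
  | add F G hF hG h1 h2 =>
    simp only [differential_add hF hG, compAd_add, neg_add]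
    exact h1.add h2
  | mul F G hF hG h1 h2 =>
    simp only [differential_mul hF hG, compAd_add, compAd_smul, neg_add, ← smul_neg]
    exact ((smoothOn_of_mem hG).smul h1).add ((smoothOn_of_mem hF).smul h2)

variable (𝔤)

/-- The canonical linear Poisson structure on the topological dual `𝔤'` (with the weak-`*`
topology) of a locally convex Lie algebra `𝔤`: the algebra is generated by the evaluations in the
elements of `𝔤`, and `{F, G}(α) = ⟨[dF(α), dG(α)], α⟩`. -/
noncomputable def linearPoisson : WeakPoissonStructure (WeakDual ℝ 𝔤) (WeakDual ℝ 𝔤) where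
  alg := linearAlg 𝔤
  smooth F hF := smoothMap_self (continuous_of_mem hF) (smoothOn_of_mem hF)
  bracket := linearBracketₗ
  skew := linearBracketₗ_skew
  jacobi := linearBracketₗ_jacobi
  leibniz := linearBracketₗ_leibniz
  separating α v hv := by
    refine DFunLike.ext _ _ fun X => ?_
    have h := hasTangentMapAt_self.1 (hv ⟨_, eval_mem X⟩)
    exact (isDifferential_eval X α v).unique h
  exists_hamiltonian H := by
    refine ⟨fun α => - compAd α (differential H.1 α),
      smoothVectorField_self (smoothOn_linearHam H.2), fun F α => hasTangentMapAt_self.2 ?_⟩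
    have h := isDifferential_differential F.2 α (- compAd α (differential H.1 α))
    have e : (- compAd α (differential H.1 α)) (differential F.1 α)
        = linearBracket F.1 H.1 α := by
      change - α ⁅differential H.1 α, differential F.1 α⁆
        = α ⁅differential F.1 α, differential H.1 α⁆
      rw [← map_neg, lie_skew]
    rw [e] at h
    exact h

variable {𝔤}
  {E : Type*} [AddCommGroup E] [Module ℝ E] [TopologicalSpace E] [IsTopologicalAddGroup E]
  [ContinuousSMul ℝ E] [LocallyConvexSpace ℝ E] [T2Space E]
  {M : Type*} [TopologicalSpace M] [ChartedSpace E M] [LCManifold E M]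

/-- The function `φ_X(m) = Φ(m)(X)` as an element of `𝒜_M`, for a map `Φ : M → 𝔤'` all of whose
functions `φ_X` lie in `𝒜_M`. -/
noncomputable def component (P : WeakPoissonStructure E M) (Φ : M → WeakDual ℝ 𝔤)
    (hΦ : ∀ X : 𝔤, (fun m => Φ m X) ∈ P.alg) (X : 𝔤) : P.alg :=
  ⟨fun m => Φ m X, hΦ X⟩

end LinearPoisson

end LCPoisson

open LCPoisson

/-!
Everything reduces to the evaluations `α ↦ α X`.

* Both brackets are biderivations and the evaluations generate the algebra of `𝔤'`. Hence pulling
  back along `Φ` defines an algebra homomorphism into `𝒜_M`, which preserves brackets as soon as it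
  does so on evaluations. Since `{α ↦ α X, α ↦ α Y}` is the evaluation in `⁅X, Y⁆`, this is the
  condition `φ ⁅X, Y⁆ = {φ X, φ Y}` (`pullbackIsLieHom_iff`).
* In the weak-`*` topology a directional derivative of `Φ` may be computed after evaluating in each
  `Y : 𝔤`. By the defining property of Hamiltonian vector fields the derivative of `φ Y` along
  `X_{φ X}` is `{φ Y, φ X}`, and `(- Φ m ∘ ad X) Y = Φ m ⁅Y, X⁆`, so the tangent map condition
  says again that `φ ⁅Y, X⁆ = {φ Y, φ X}` for all `X`, `Y` (`forall_hasTangentMapAt_ham_iff`).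
-/

namespace LCPoisson

section Bracket

variable {E : Type*} [AddCommGroup E] [Module ℝ E] [TopologicalSpace E] [IsTopologicalAddGroup E]
  [ContinuousSMul ℝ E] [LocallyConvexSpace ℝ E] [T2Space E]
  {M : Type*} [TopologicalSpace M] [ChartedSpace E M] [LCManifold E M]
  (P : WeakPoissonStructure E M)

theorem WeakPoissonStructure.hasTangentMapAt_ham (F H : P.alg) (m : M) :
    HasTangentMapAt (F : M → ℝ) m (P.ham H m) ((P.bracket F H : M → ℝ) m) :=
  (P.exists_hamiltonian H).choose_spec.2 F m

theorem WeakPoissonStructure.bracket_algebraMap (F : P.alg) (c : ℝ) :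
    P.bracket F (algebraMap ℝ P.alg c) = 0 := by
  have h := P.leibniz F 1 1
  simp only [mul_one, one_mul, left_eq_add] at h
  rw [Algebra.algebraMap_eq_smul_one, map_smul, h, smul_zero]

theorem WeakPoissonStructure.bracket_algebraMap_left (F : P.alg) (c : ℝ) :
    P.bracket (algebraMap ℝ P.alg c) F = 0 := by
  rw [P.skew, P.bracket_algebraMap, neg_zero]

theorem WeakPoissonStructure.leibniz_left (F G H : P.alg) :
    P.bracket (F * G) H = F * P.bracket G H + P.bracket F H * G := by
  rw [P.skew, P.leibniz, P.skew H F, P.skew H G]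
  ring

end Bracket

/-- Directional derivatives in the weak-`*` topology may be computed pointwise. -/
theorem hasDirDerivAt_weakDual_iff {E V : Type*} [AddCommGroup E] [Module ℝ E]
    [AddCommGroup V] [Module ℝ V] [TopologicalSpace V]
    {f : E → WeakDual ℝ V} {w : WeakDual ℝ V} {x h : E} :
    HasDirDerivAt f w x h ↔ ∀ Y : V, HasDirDerivAt (fun y => f y Y) (w Y) x h :=
  WeakBilin.tendsto_iff_forall_eval_tendsto _ ContinuousLinearMap.coe_injective

section Pullback

variable {𝔤 : Type*} [LieRing 𝔤] [LieAlgebra ℝ 𝔤] [TopologicalSpace 𝔤] [IsTopologicalAddGroup 𝔤]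
  [ContinuousSMul ℝ 𝔤] [LocallyConvexSpace ℝ 𝔤] [T2Space 𝔤]
  {E : Type*} [AddCommGroup E] [Module ℝ E] [TopologicalSpace E] [IsTopologicalAddGroup E]
  [ContinuousSMul ℝ E] [LocallyConvexSpace ℝ E] [T2Space E]
  {M : Type*} [TopologicalSpace M] [ChartedSpace E M] [LCManifold E M]
  (P : WeakPoissonStructure E M) (Φ : M → WeakDual ℝ 𝔤)
  (hΦ : ∀ X : 𝔤, (fun m => Φ m X) ∈ P.alg)

theorem comp_mem_alg (hΦ : ∀ X : 𝔤, (fun m => Φ m X) ∈ P.alg) (F : linearAlg 𝔤) :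
    (F : WeakDual ℝ 𝔤 → ℝ) ∘ Φ ∈ P.alg := by
  induction F using linearAlg_induction with
  | eval X => exact hΦ X
  | const c => exact algebraMap_mem P.alg c
  | add F G hF hG => exact add_mem hF hG
  | mul F G hF hG => exact mul_mem hF hG

/-- The pullback `F ↦ F ∘ Φ`, as a homomorphism of algebras from the polynomial functions
on `𝔤'` to `𝒜_M`. -/
def pullbackAlgHom : linearAlg 𝔤 →ₐ[ℝ] P.alg where
  toFun F := ⟨(F : WeakDual ℝ 𝔤 → ℝ) ∘ Φ, comp_mem_alg P Φ hΦ F⟩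
  map_one' := rfl
  map_mul' _ _ := rfl
  map_zero' := rfl
  map_add' _ _ := rfl
  commutes' _ := rfl

/-- By the Leibniz rule in both arguments it is enough to compare the brackets on evaluations. -/
theorem pullbackAlgHom_bracket
    (h : ∀ X Y : 𝔤,
      component P Φ hΦ ⁅X, Y⁆ = P.bracket (component P Φ hΦ X) (component P Φ hΦ Y))
    (F G : linearAlg 𝔤) :
    pullbackAlgHom P Φ hΦ (linearBracketₗ F G) =
      P.bracket (pullbackAlgHom P Φ hΦ F) (pullbackAlgHom P Φ hΦ G) := by
  induction F using linearAlg_induction with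
  | const c =>
    rw [linearBracketₗ_const_left, map_zero, AlgHom.commutes, P.bracket_algebraMap_left]
  | add F F' h1 h2 => simp only [map_add, LinearMap.add_apply, h1, h2]
  | mul F F' h1 h2 =>
    simp only [linearBracketₗ_leibniz_left, P.leibniz_left, map_add, map_mul, h1, h2]
  | eval X =>
    induction G using linearAlg_induction with
    | const c => rw [linearBracketₗ_const, map_zero, AlgHom.commutes, P.bracket_algebraMap]
    | add G G' h1 h2 => simp only [map_add, h1, h2]
    | mul G G' h1 h2 => simp only [linearBracketₗ_leibniz, P.leibniz, map_add, map_mul, h1, h2]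
    | eval Y =>
      refine Eq.trans (Subtype.ext ?_) (h X Y)
      change linearBracket _ _ ∘ Φ = _
      rw [linearBracket_eval]
      rfl

variable [ContinuousLieBracket 𝔤]

theorem pullbackIsLieHom_iff :
    PullbackIsLieHom P (linearPoisson 𝔤) Φ ↔ ∀ X Y : 𝔤,
      component P Φ hΦ ⁅X, Y⁆ = P.bracket (component P Φ hΦ X) (component P Φ hΦ Y) := by
  constructor
  · rintro ⟨_, hb⟩ X Y
    refine Subtype.ext (Eq.trans ?_ (hb ⟨_, eval_mem X⟩ ⟨_, eval_mem Y⟩))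
    change _ = linearBracket _ _ ∘ Φ
    rw [linearBracket_eval]
    rfl
  · exact fun h => ⟨comp_mem_alg P Φ hΦ,
      fun F G => congrArg Subtype.val (pullbackAlgHom_bracket P Φ hΦ h F G)⟩

/-- Evaluated in `Y`, the tangent map condition compares `(- Φ m ∘ ad X) Y = Φ m ⁅Y, X⁆` with the
derivative `{φ Y, φ X}` of `φ Y` along the Hamiltonian vector field of `φ X`. -/
theorem hasTangentMapAt_ham_iff (m : M) (X : 𝔤) :
    HasTangentMapAt Φ m (P.ham (component P Φ hΦ X) m) (- compAd (Φ m) X) ↔ ∀ Y : 𝔤,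
      (component P Φ hΦ ⁅Y, X⁆ : M → ℝ) m =
        (P.bracket (component P Φ hΦ Y) (component P Φ hΦ X) : M → ℝ) m := by
  refine hasDirDerivAt_weakDual_iff.trans (forall_congr' fun Y => ?_)
  have e : (- compAd (Φ m) X) Y = (component P Φ hΦ ⁅Y, X⁆ : M → ℝ) m := by
    change - Φ m ⁅X, Y⁆ = Φ m ⁅Y, X⁆
    rw [← map_neg, lie_skew]
  have hY := P.hasTangentMapAt_ham (component P Φ hΦ Y) (component P Φ hΦ X) m
  rw [e]
  refine ⟨fun h => HasDirDerivAt.unique h hY, fun h => ?_⟩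
  rw [h]
  exact hY

theorem forall_hasTangentMapAt_ham_iff :
    (∀ (m : M) (X : 𝔤),
      HasTangentMapAt Φ m (P.ham (component P Φ hΦ X) m) (- compAd (Φ m) X)) ↔ ∀ X Y : 𝔤,
      component P Φ hΦ ⁅X, Y⁆ = P.bracket (component P Φ hΦ X) (component P Φ hΦ Y) := by
  simp only [hasTangentMapAt_ham_iff]
  exact ⟨fun h X Y => Subtype.ext (funext fun m => h m Y X),
    fun h m X Y => congrFun (congrArg Subtype.val (h Y X)) m⟩

end Pullback

end LCPoisson

theorem corollary3p2
    {𝔤 : Type*} [LieRing 𝔤] [LieAlgebra ℝ 𝔤] [TopologicalSpace 𝔤] [IsTopologicalAddGroup 𝔤]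
    [ContinuousSMul ℝ 𝔤] [LocallyConvexSpace ℝ 𝔤] [T2Space 𝔤] [ContinuousLieBracket 𝔤]
    {E : Type*} [AddCommGroup E] [Module ℝ E] [TopologicalSpace E] [IsTopologicalAddGroup E]
    [ContinuousSMul ℝ E] [LocallyConvexSpace ℝ E] [T2Space E]
    {M : Type*} [TopologicalSpace M] [ChartedSpace E M] [LCManifold E M]
    (P : WeakPoissonStructure E M) (Φ : M → WeakDual ℝ 𝔤)
    (hΦ : ∀ X : 𝔤, (fun m => Φ m X) ∈ P.alg) :
    [ PullbackIsLieHom P (linearPoisson 𝔤) Φ,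
      ∀ X Y : 𝔤,
        component P Φ hΦ ⁅X, Y⁆ = P.bracket (component P Φ hΦ X) (component P Φ hΦ Y),
      ∀ (m : M) (X : 𝔤),
        HasTangentMapAt Φ m (P.ham (component P Φ hΦ X) m) (- compAd (Φ m) X) ].TFAE
    ∧ (SmoothMap E (WeakDual ℝ 𝔤) Φ →
      [ IsPoissonMap P (linearPoisson 𝔤) Φ,
        ∀ X Y : 𝔤,
          component P Φ hΦ ⁅X, Y⁆ = P.bracket (component P Φ hΦ X) (component P Φ hΦ Y),
        ∀ (m : M) (X : 𝔤),
          HasTangentMapAt Φ m (P.ham (component P Φ hΦ X) m) (- compAd (Φ m) X) ].TFAE) := by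
  have h12 := pullbackIsLieHom_iff P Φ hΦ
  have h32 := forall_hasTangentMapAt_ham_iff P Φ hΦ
  refine ⟨?_, fun hs => ?_⟩
  · tfae_have 1 ↔ 2 := h12
    tfae_have 3 ↔ 2 := h32
    tfae_finish
  · tfae_have 1 ↔ 2 := ⟨fun h => h12.1 h.2, fun h => ⟨hs, h12.2 h⟩⟩
    tfae_have 3 ↔ 2 := h32
    tfae_finish
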